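/- Let $P$ be a finite partially ordered set with $n$ elements. For $k\ge 0$ let $c_k(P)$ be the maximal number of elements in a union of $k$ chains (totally ordered subsets) of $P$, put $\lambda_k=c_k(P)-c_{k-1}(P)$ for $k\ge 1$, and let $\lambda(P)=(\lambda_1,\lambda_2,\dots)$. The incidence algebra $I(P)$ is the algebra of complex matrices $M$ with rows and columns indexed by $P$ such that $M_{ij}\ne 0$ implies $i\le j$ in $P$. A nilpotent element $M\in I(P)$ is called generic if its entries $M_{ij}$, for $i<j$ in $P$, are algebraically independent over $\mathbb{Q}$. The Jordan partition of an $n\times n$ complex matrix is the sequence $(n_1,n_2,\dots)$ of the sizes $n_1\ge n_2\ge\cdots$ of the blocks of its Jordan canonical form, continued by zeros. Theorem. If $M$ is a generic nilpotent element of $I(P)$, then the Jordan partition of $M$ is equal to $\lambda(P)$; that is, $n_k=\lambda_k$ for all $k\ge 1$. -/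

import Mathlib

/-- The possible numbers of elements in a union of `k` chains of the poset `P`
(the chains may overlap, coincide or be empty). -/
def chainUnionSizes (P : Type*) [PartialOrder P] (k : ℕ) : Set ℕ :=
  {m | ∃ C : Fin k → Set P, (∀ i, IsChain (· ≤ ·) (C i)) ∧ (⋃ i, C i).ncard = m}

/-- `maxChainUnion P k` is the number `c_k(P)`: the maximal number of elements in a union of
`k` chains of the finite poset `P`. -/
noncomputable def maxChainUnion (P : Type*) [PartialOrder P] (k : ℕ) : ℕ :=
  sSup (chainUnionSizes P k)

/-- For finite `P` the supremum defining `c_k(P)` is a genuine maximum. -/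
theorem maxChainUnion_isGreatest (P : Type*) [PartialOrder P] [Finite P] (k : ℕ) :
    IsGreatest (chainUnionSizes P k) (maxChainUnion P k) := by
  have hb : BddAbove (chainUnionSizes P k) := by
    refine ⟨Nat.card P, ?_⟩
    rintro m ⟨C, -, rfl⟩
    exact Set.ncard_le_card _
  have hne : (chainUnionSizes P k).Nonempty :=
    ⟨_, fun _ => ∅, fun _ => by simp [IsChain], rfl⟩
  exact ⟨Nat.sSup_mem hne hb, fun m hm => le_csSup hb hm⟩

/-- `c_k(P) ≤ c_{k+1}(P)`, so that the subtraction in `chainShape` is not truncated. -/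
theorem maxChainUnion_le_succ (P : Type*) [PartialOrder P] [Finite P] (k : ℕ) :
    maxChainUnion P k ≤ maxChainUnion P (k + 1) := by
  obtain ⟨C, hC, h⟩ := (maxChainUnion_isGreatest P k).1
  refine (maxChainUnion_isGreatest P (k + 1)).2
    ⟨Fin.cons ∅ C, fun i => ?_, ?_⟩
  · refine Fin.cases ?_ (fun j => ?_) i
    · simp [IsChain]
    · simpa using hC j
  · rw [← h]
    congr 1
    ext x
    simp

/-- The partition `λ(P)`, as a sequence of row lengths followed by zeros. Sequences are indexed
from `0`: the value at `k` is `λ_{k+1} = c_{k+1}(P) - c_k(P)`. -/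
noncomputable def chainShape (P : Type*) [PartialOrder P] (k : ℕ) : ℕ :=
  maxChainUnion P (k + 1) - maxChainUnion P k

/-- The incidence algebra `I(P)` of a finite poset `P`: all complex matrices `M`, with rows and
columns indexed by `P`, such that `M i j ≠ 0` implies `i ≤ j`. -/
def incidenceMatrixAlgebra (P : Type*) [PartialOrder P] [Fintype P] [DecidableEq P] :
    Subalgebra ℂ (Matrix P P ℂ) where
  carrier := {M | ∀ i j, M i j ≠ 0 → i ≤ j}
  mul_mem' := by
    intro A B hA hB i j h
    rw [Matrix.mul_apply] at h
    obtain ⟨l, -, hl⟩ := Finset.exists_ne_zero_of_sum_ne_zero h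
    exact (hA i l (left_ne_zero_of_mul hl)).trans (hB l j (right_ne_zero_of_mul hl))
  add_mem' := by
    intro A B hA hB i j h
    by_contra hij
    have h1 : A i j = 0 := by_contra fun h1 => hij (hA i j h1)
    have h2 : B i j = 0 := by_contra fun h2 => hij (hB i j h2)
    exact h (by simp [h1, h2])
  algebraMap_mem' := by
    intro r i j h
    by_contra hij
    have hne : i ≠ j := fun e => hij e.le
    exact h (by simp [Matrix.algebraMap_matrix_apply, hne])

/-- `M` is a generic nilpotent element of the incidence algebra `I(P)`: it is a nilpotent element
of `I(P)` whose entries `M i j`, `i < j` in `P`, are algebraically independent over `ℚ`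
(as a family indexed by the pairs `i < j`). -/
structure IsGenericNilpotent {P : Type*} [PartialOrder P] [Fintype P] [DecidableEq P]
    (M : Matrix P P ℂ) : Prop where
  mem : M ∈ incidenceMatrixAlgebra P
  nilpotent : IsNilpotent M
  generic : AlgebraicIndependent ℚ (fun p : {p : P × P // p.1 < p.2} => M p.1.1 p.1.2)

/-- The `m × m` Jordan block with eigenvalue `μ`: `μ` on the diagonal and `1` just above it. -/
def jordanBlock (μ : ℂ) (m : ℕ) : Matrix (Fin m) (Fin m) ℂ :=
  Matrix.of fun i j => if i = j then μ else if (i : ℕ) + 1 = (j : ℕ) then 1 else 0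

/-- `ν` is the Jordan partition of the square complex matrix `M`: `M` is similar to a block
diagonal matrix formed by Jordan blocks of positive sizes `n_1 ≥ n_2 ≥ ⋯ ≥ n_r`, and `ν` is the
sequence `n_1, n_2, …, n_r, 0, 0, …` (indexed from `0`). The bijection `e` only numbers the rows
and columns. -/
def IsJordanPartition {ι : Type*} [Fintype ι] [DecidableEq ι] (M : Matrix ι ι ℂ) (ν : ℕ → ℕ) :
    Prop :=
  ∃ (r : ℕ) (size : Fin r → ℕ) (eig : Fin r → ℂ) (e : (Σ i : Fin r, Fin (size i)) ≃ ι)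
    (S : (Matrix ι ι ℂ)ˣ),
    (∀ i, 0 < size i) ∧ Antitone size ∧
    M = S.val * Matrix.reindex e e
      (Matrix.blockDiagonal' fun i => jordanBlock (eig i) (size i)) * S⁻¹.val ∧
    ∀ k, ν k = if h : k < r then size ⟨k, h⟩ else 0

/-! The proof compares the lowest power of `X` occurring in the corank-`k` minors of the pencil `X •
1 + M` with the same exponent for the Jordan form of `M`. Conjugation preserves common divisors of
minors of a given size, because the minors of `B * A * C` are linear combinations of those of `A`
(`Matrix.dvd_minors_mul_mul`).

A nonzero term in such a minor is a partial injection moving weakly upwards in `P`. Its fixed points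
contribute factors `X`; every element that is not a fixed point lies on one of at most `k` upward
paths, so there are at least `n - c_k` fixed points (`X_pow_dvd_minor_pencil`). Conversely,
successor arcs along an optimal family of `k` chains give a 0/1 specialisation with a triangular
minor of low degree, and algebraic independence carries the nonvanishing coefficient over to `M`
(`exists_minor_pencil_generic`).

The nilpotent Jordan matrix lives on a disjoint union of chains, where the exponent is `n - (n_1 + ⋯
+ n_k)`. Equating exponents gives `n_1 + ⋯ + n_k = c_k`
(`IsJordanPartition.sum_range_eq_maxChainUnion`). -/

open Polynomial

/-! ### Determinants and divisibility of minors -/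

/-- If the off-diagonal support of a matrix strictly decreases a potential, the determinant is the
product of the diagonal entries. -/
theorem Matrix.det_eq_prod_diag_of_potential {ι R : Type*} [Fintype ι] [DecidableEq ι] [CommRing R]
    (A : Matrix ι ι R) (f : ι → ℤ) (h : ∀ i j, i ≠ j → A i j ≠ 0 → f j < f i) :
    A.det = ∏ i, A i i := by
  rw [Matrix.det_apply, Finset.sum_eq_single (1 : Equiv.Perm ι)]
  · simp
  · intro π _ hπ
    suffices ∃ i, A (π i) i = 0 by
      obtain ⟨i, hi⟩ := this
      rw [Finset.prod_eq_zero (f := fun i => A (π i) i) (Finset.mem_univ i) hi, smul_zero]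
    by_contra! hne
    obtain ⟨a, ha⟩ : ∃ a, π a ≠ a := by
      by_contra! hall
      exact hπ (Equiv.ext hall)
    -- A nonzero term of a nonidentity permutation would raise the total potential, yet a
    -- permutation only reorders that sum.
    have hlt : ∑ i, f i < ∑ i, f (π i) := by
      refine Finset.sum_lt_sum (fun i _ => ?_) ⟨a, Finset.mem_univ a, h _ _ ha (hne a)⟩
      by_cases hi : π i = i
      · rw [hi]
      · exact (h _ _ hi (hne i)).le
    exact hlt.ne (Equiv.sum_comp π f).symm
  · simp

/-- A common divisor of all `m`-minors of `A` divides all `m`-minors of `B * A`. -/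
theorem Matrix.dvd_minors_mul_left {P R : Type*} [Fintype P] [CommRing R] {m : ℕ} {d : R}
    (A B : Matrix P P R) (h : ∀ r s : Fin m → P, d ∣ (A.submatrix r s).det) (r s : Fin m → P) :
    d ∣ ((B * A).submatrix r s).det := by
  classical
  -- Rows of `B * A` are combinations of rows of `A`; multilinearity then expands the minor.
  have e : ((B * A).submatrix r s).det =
      Matrix.detRowAlternating (fun i => ∑ p, B (r i) p • fun j => A p (s j)) := by
    change Matrix.detRowAlternating _ = _
    congr 1
    ext i j
    simp [Matrix.mul_apply, Finset.sum_apply]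
  rw [e, ← AlternatingMap.coe_multilinearMap, MultilinearMap.map_sum]
  refine Finset.dvd_sum fun g _ => ?_
  rw [MultilinearMap.map_smul_univ, smul_eq_mul]
  exact Dvd.dvd.mul_left (h g s) _

/-- A common divisor of all `m`-minors of `A` divides all `m`-minors of `B * A * C`. -/
theorem Matrix.dvd_minors_mul_mul {P R : Type*} [Fintype P] [CommRing R] {m : ℕ} {d : R}
    (A B C : Matrix P P R) (h : ∀ r s : Fin m → P, d ∣ (A.submatrix r s).det) (r s : Fin m → P) :
    d ∣ ((B * A * C).submatrix r s).det := by
  rw [← Matrix.det_transpose, Matrix.transpose_submatrix, Matrix.transpose_mul]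
  refine Matrix.dvd_minors_mul_left _ _ (fun r s => ?_) s r
  rw [← Matrix.transpose_submatrix, Matrix.det_transpose]
  exact Matrix.dvd_minors_mul_left _ _ h s r

/-! ### Matrix pencils -/

/-- The matrix pencil `X • 1 + N`. -/
noncomputable def Matrix.pencil {P R : Type*} [DecidableEq P] [CommRing R] (N : Matrix P P R) :
    Matrix P P R[X] :=
  Matrix.of fun i j => (if i = j then X else 0) + C (N i j)

theorem Matrix.pencil_eq {P R : Type*} [Fintype P] [DecidableEq P] [CommRing R]
    (N : Matrix P P R) : N.pencil = Matrix.scalar P (X : R[X]) + (C : R →+* R[X]).mapMatrix N := by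
  ext1 i j
  simp [Matrix.pencil, Matrix.diagonal_apply]

theorem Matrix.pencil_conj {P R : Type*} [Fintype P] [DecidableEq P] [CommRing R]
    (N : Matrix P P R) (S : (Matrix P P R)ˣ) :
    (S.val * N * S⁻¹.val).pencil =
      (C : R →+* R[X]).mapMatrix S.val * N.pencil * (C : R →+* R[X]).mapMatrix S⁻¹.val := by
  rw [Matrix.pencil_eq, Matrix.pencil_eq, mul_add, add_mul, ← map_mul, ← map_mul,
    ← (Matrix.scalar_commute (X : R[X]) (fun _ => Commute.all _ _) _).eq,
    mul_assoc (Matrix.scalar P X), ← map_mul, Units.mul_inv, map_one, mul_one]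

/-- Allows one universal minor to be specialised both to a 0/1 matrix and to `M`. -/
theorem Matrix.map_det_pencil_submatrix {P R R' : Type*} [DecidableEq P] [CommRing R] [CommRing R']
    {m : ℕ} (φ : R →+* R') (N : Matrix P P R) (r s : Fin m → P) :
    (N.pencil.submatrix r s).det.map φ = ((N.map φ).pencil.submatrix r s).det := by
  rw [← Polynomial.coe_mapRingHom, RingHom.map_det]
  congr 1
  ext1 i j
  by_cases h : r i = s j <;> simp [Matrix.pencil, h]

/-- A partial transversal `i ↦ σ i` that is triangular with respect to a potential
gives a minor of the pencil with a nonzero coefficient of small degree. -/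
theorem Matrix.exists_minor_pencil_coeff_ne_zero {P R : Type*} [DecidableEq P] [CommRing R]
    [IsDomain R] (N : Matrix P P R) (I : Finset P) (σ : P → P) (f : P → ℤ) {m : ℕ}
    (hm : m ≤ I.card)
    (htri : ∀ i ∈ I, ∀ j ∈ I, i ≠ j → (σ j = i ∨ N i (σ j) ≠ 0) → f j < f i)
    (harc : ∀ i ∈ I, σ i ≠ i → N i (σ i) ≠ 0) (hdiag : ∀ i, N i i = 0) :
    ∃ r s : Fin m → P, ∃ l ≤ (I.filter fun i => σ i = i).card,
      ((N.pencil.submatrix r s).det).coeff l ≠ 0 := by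
  obtain ⟨I', hI', hcard⟩ := Finset.exists_subset_card_eq hm
  let g : Fin m ≃ I' := (I'.equivFinOfCardEq hcard).symm
  let r : Fin m → P := fun i => g i
  have hrI : ∀ i, r i ∈ I := fun i => hI' (g i).2
  have hr : Function.Injective r := Subtype.val_injective.comp g.injective
  refine ⟨r, σ ∘ r, (Finset.univ.filter fun i => σ (r i) = r i).card, ?_, ?_⟩
  · refine Finset.card_le_card_of_injOn r (fun i hi => ?_) hr.injOn
    simp only [Finset.coe_filter, Finset.mem_univ, true_and, Set.mem_ofPred_eq] at hi
    simp [hrI i, hi]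
  · rw [Matrix.det_eq_prod_diag_of_potential _ (fun i => f (r i))]
    · have e : ∏ i, N.pencil.submatrix r (σ ∘ r) i i =
          C (∏ i with ¬ σ (r i) = r i, N (r i) (σ (r i))) *
            X ^ (Finset.univ.filter fun i => σ (r i) = r i).card := by
        rw [← Finset.prod_filter_mul_prod_filter_not _ (fun i => σ (r i) = r i), mul_comm,
          map_prod]
        congr 1
        · refine Finset.prod_congr rfl fun i hi => ?_
          have : ¬ r i = σ (r i) := fun h => (Finset.mem_filter.1 hi).2 h.symm
          simp [Matrix.pencil, this]
        · rw [Finset.prod_eq_pow_card]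
          intro i hi
          simp [Matrix.pencil, (Finset.mem_filter.1 hi).2, hdiag]
      rw [e, Polynomial.coeff_C_mul, Polynomial.coeff_X_pow, if_pos rfl, mul_one,
        Finset.prod_ne_zero_iff]
      exact fun i hi => harc _ (hrI i) (Finset.mem_filter.1 hi).2
    · intro i j hij hne
      refine htri _ (hrI i) _ (hrI j) (hr.ne hij) ?_
      by_contra! hcon
      exact hne (by simp [Matrix.pencil, hcon.1.symm, hcon.2])

/-! ### Partial injections and families of chains -/

/-- The number of elements covered by the paths of a partial injection `r i ↦ s i` moving up. -/
theorem card_sub_loops_le_maxChainUnion {P : Type*} [PartialOrder P] [Fintype P] [DecidableEq P]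
    {m k : ℕ} (hmk : Fintype.card P ≤ m + k) (r s : Fin m → P) (hr : r.Injective)
    (hs : s.Injective) (hrs : ∀ i, r i ≤ s i) :
    Fintype.card P ≤ (Finset.univ.filter fun i => r i = s i).card + maxChainUnion P k := by
  let step : P → P → Prop := fun a b => ∃ i, r i = a ∧ s i = b
  have hstep : Relator.RightUnique step := by
    rintro a b c ⟨i, rfl, rfl⟩ ⟨j, hj, rfl⟩
    rw [hr hj]
  have hle : ∀ a b, Relation.ReflTransGen step a b → a ≤ b := by
    intro a b h
    induction h with
    | refl => exact le_rfl
    | tail _ h ih =>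
      obtain ⟨i, rfl, rfl⟩ := h
      exact ih.trans (hrs i)
  let starts : Finset P := (Finset.univ.image s)ᶜ
  have hcard : starts.card ≤ k := by
    rw [Finset.card_compl, Finset.card_image_of_injective _ hs]
    simp
    omega
  -- One upward path per starting point; surplus indices get the empty chain.
  let C : Fin k → Set P := fun a =>
    {q | ∃ h : a.1 < starts.card,
      Relation.ReflTransGen step (starts.equivFin.symm ⟨a, h⟩) q}
  have hC : ∀ a, IsChain (· ≤ ·) (C a) := by
    rintro a x ⟨h, hx⟩ y ⟨_, hy⟩ _
    exact (Relation.ReflTransGen.total_of_right_unique hstep hx hy).imp (hle _ _) (hle _ _)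
  -- Trace predecessors downwards: by injectivity of `r` the predecessor of a non-loop is again not
  -- a loop, so the descent ends at a start.
  have hcov : ∀ q, (∀ i, r i = s i → s i ≠ q) → ∃ a ∈ starts, Relation.ReflTransGen step a q := by
    intro q
    induction q using (wellFounded_lt (α := P)).induction with
    | _ q ih =>
      intro hq
      by_cases hqs : q ∈ starts
      · exact ⟨q, hqs, .refl⟩
      · simp only [starts, Finset.mem_compl, Finset.mem_image, Finset.mem_univ, true_and,
          not_not] at hqs
        obtain ⟨i, rfl⟩ := hqs
        have hi : r i ≠ s i := fun h => hq i h rfl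
        obtain ⟨a, ha, hpath⟩ := ih (r i) (lt_of_le_of_ne (hrs i) hi) fun j hj hji => by
          have : j = i := hr (hj.trans hji)
          subst this
          exact hi hj
        exact ⟨a, ha, hpath.tail ⟨i, rfl, rfl⟩⟩
  have hmax : (⋃ a, C a).ncard ≤ maxChainUnion P k :=
    (maxChainUnion_isGreatest P k).2 ⟨C, hC, rfl⟩
  have hsub : (Finset.univ : Finset P) ⊆
      (Finset.univ.filter fun i => r i = s i).image s ∪ (⋃ a, C a).toFinite.toFinset := by
    intro q _
    by_cases hq : ∀ i, r i = s i → s i ≠ q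
    · obtain ⟨a, ha, hpath⟩ := hcov q hq
      refine Finset.mem_union_right _ ?_
      simp only [Set.Finite.mem_toFinset, Set.mem_iUnion]
      refine ⟨⟨starts.equivFin ⟨a, ha⟩, (Fin.is_lt _).trans_le hcard⟩,
        (starts.equivFin ⟨a, ha⟩).is_lt, ?_⟩
      simpa using hpath
    · push Not at hq
      obtain ⟨i, hi, rfl⟩ := hq
      exact Finset.mem_union_left _ (Finset.mem_image_of_mem _ (by simpa using hi))
  have h1 := (Finset.card_le_card hsub).trans (Finset.card_union_le _ _)
  rw [← Set.ncard_eq_toFinset_card] at h1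
  have h2 := Finset.card_image_le (s := Finset.univ.filter fun i => r i = s i) (f := s)
  rw [Finset.card_univ] at h1
  omega

/-- For a strictly upper triangular element of the incidence algebra, all minors of the pencil of
corank `k` are divisible by `X ^ (n - c_k)`. -/
theorem X_pow_dvd_minor_pencil {P R : Type*} [PartialOrder P] [Fintype P] [DecidableEq P]
    [CommRing R] (N : Matrix P P R) (hN : ∀ i j, N i j ≠ 0 → i < j) {m k : ℕ}
    (hmk : Fintype.card P ≤ m + k) (r s : Fin m → P) :
    X ^ (Fintype.card P - maxChainUnion P k) ∣ (N.pencil.submatrix r s).det := by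
  by_cases hr : r.Injective
  swap
  · obtain ⟨i, j, h, hij⟩ := Function.not_injective_iff.1 hr
    rw [Matrix.det_zero_of_row_eq hij (by ext a; simp [h])]
    exact dvd_zero _
  by_cases hs : s.Injective
  swap
  · obtain ⟨i, j, h, hij⟩ := Function.not_injective_iff.1 hs
    rw [Matrix.det_zero_of_column_eq hij (by intro a; simp [h])]
    exact dvd_zero _
  rw [Matrix.det_apply]
  refine Finset.dvd_sum fun π _ => Dvd.dvd.trans ?_ (dvd_smul_of_dvd _ dvd_rfl)
  by_cases hle : ∀ i, r (π i) ≤ s i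
  · have h := card_sub_loops_le_maxChainUnion hmk (r ∘ π) s (hr.comp π.injective) hs hle
    calc X ^ (Fintype.card P - maxChainUnion P k)
        ∣ (X : R[X]) ^ (Finset.univ.filter fun i => (r ∘ π) i = s i).card :=
          pow_dvd_pow _ (by omega)
      _ ∣ ∏ i, N.pencil.submatrix r s (π i) i := by
          rw [← Finset.prod_const]
          refine (Finset.prod_dvd_prod_of_dvd _ _ fun i hi => ?_).trans
            (Finset.prod_dvd_prod_of_subset _ _ _ (Finset.filter_subset _ _))
          have hi' : r (π i) = s i := (Finset.mem_filter.1 hi).2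
          have h0 : N (s i) (s i) = 0 := by_contra fun h => (hN _ _ h).false
          simp [Matrix.pencil, hi', h0]
  · push Not at hle
    obtain ⟨i, hi⟩ := hle
    rw [Finset.prod_eq_zero (Finset.mem_univ i)]
    · exact dvd_zero _
    · have h0 : N (r (π i)) (s i) = 0 := by_contra fun h => hi (hN _ _ h).le
      have h1 : ¬ r (π i) = s i := fun h => hi h.le
      simp [Matrix.pencil, h0, h1]

/-- An optimal union of `k` chains, as a partial injection moving up: `σ` sends an element to its
successor in its chain, or to itself if it lies in no chain, and is defined on `I`. -/
theorem exists_chain_successor {P : Type*} [PartialOrder P] [Fintype P] [DecidableEq P] (k : ℕ) :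
    ∃ (I : Finset P) (σ : P → P), Fintype.card P - k ≤ I.card ∧ Set.InjOn σ I ∧
      (∀ i ∈ I, i ≤ σ i) ∧
      (I.filter fun i => σ i = i).card ≤ Fintype.card P - maxChainUnion P k := by
  classical
  obtain ⟨C, hC, hmax⟩ := (maxChainUnion_isGreatest P k).1
  let U : Finset P := Finset.univ.filter fun x => ∃ i, x ∈ C i
  have hU : U.card = maxChainUnion P k := by
    rw [← hmax, Set.ncard_eq_toFinset_card']
    congr 1
    ext x
    simp [U]
  -- Labels in `Option` still exist when `k = 0`.
  have hlab : ∀ x : P, ∃ o : Option (Fin k), (x ∈ U → ∃ i, o = some i ∧ x ∈ C i) := fun x => by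
    by_cases hx : x ∈ U
    · obtain ⟨i, hi⟩ := (Finset.mem_filter.1 hx).2
      exact ⟨some i, fun _ => ⟨i, rfl, hi⟩⟩
    · exact ⟨none, fun h => absurd h hx⟩
  choose b hb using hlab
  have htot : ∀ x ∈ U, ∀ y ∈ U, b x = b y → x ≤ y ∨ y ≤ x := by
    intro x hx y hy hxy
    obtain ⟨i, hi, hxi⟩ := hb x hx
    obtain ⟨j, hj, hyj⟩ := hb y hy
    obtain rfl : i = j := by simpa [hi, hj] using hxy
    exact (hC i).total hxi hyj
  let above : P → Finset P := fun x => U.filter fun y => b x = b y ∧ x < y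
  have hσ : ∀ x, ∃ y, (x ∉ U → y = x) ∧
      (x ∈ U → (above x).Nonempty → y ∈ above x ∧ ∀ z ∈ above x, y ≤ z) := by
    intro x
    by_cases hx : x ∈ U
    · by_cases hne : (above x).Nonempty
      · obtain ⟨y, hy, hmin⟩ := (above x).exists_minimal hne
        refine ⟨y, fun h => absurd hx h, fun _ _ => ⟨hy, fun z hz => ?_⟩⟩
        have hy' := Finset.mem_filter.1 hy
        have hz' := Finset.mem_filter.1 hz
        rcases htot y hy'.1 z hz'.1 (hy'.2.1.symm.trans hz'.2.1) with h | h
        · exact h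
        · exact hmin hz h
      · exact ⟨x, fun _ => rfl, fun _ h => absurd h hne⟩
    · exact ⟨x, fun _ => rfl, fun h => absurd h hx⟩
  choose σ hσ1 hσ2 using hσ
  let I : Finset P := Finset.univ.filter fun x => x ∈ U → (above x).Nonempty
  have hIU : ∀ x ∈ I, x ∈ U → σ x ∈ U ∧ b x = b (σ x) ∧ x < σ x ∧ ∀ z ∈ above x, σ x ≤ z := by
    intro x hx hxU
    obtain ⟨h1, h2⟩ := hσ2 x hxU ((Finset.mem_filter.1 hx).2 hxU)
    have h3 := Finset.mem_filter.1 h1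
    exact ⟨h3.1, h3.2.1, h3.2.2, h2⟩
  refine ⟨I, σ, ?_, ?_, ?_, ?_⟩
  -- Elements outside `I` are tops of their label classes, and each class, being totally ordered,
  -- has only one top.
  · have hle : Iᶜ.card ≤ (Finset.univ.image (some : Fin k → Option (Fin k))).card := by
      have hIc : ∀ x ∈ Iᶜ, x ∈ U ∧ ¬ (above x).Nonempty := by
        intro x hx
        simpa [I] using hx
      refine Finset.card_le_card_of_injOn b (fun x hx => ?_) (fun x hx y hy hxy => ?_)
      · obtain ⟨i, hi, -⟩ := hb x (hIc x hx).1
        simp [hi]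
      · obtain ⟨hxU, hx'⟩ := hIc x hx
        obtain ⟨hyU, hy'⟩ := hIc y hy
        by_contra hne
        rcases htot x hxU y hyU hxy with h | h
        · exact hx' ⟨y, Finset.mem_filter.2 ⟨hyU, hxy, lt_of_le_of_ne h hne⟩⟩
        · exact hy' ⟨x, Finset.mem_filter.2 ⟨hxU, hxy.symm, lt_of_le_of_ne h (Ne.symm hne)⟩⟩
    rw [Finset.card_image_of_injective _ (Option.some_injective _), Finset.card_compl] at hle
    simp at hle
    omega
  · intro x hx y hy hxy
    by_cases hxU : x ∈ U
    · obtain ⟨hx1, hx2, hx3, hx4⟩ := hIU x hx hxU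
      by_cases hyU : y ∈ U
      · obtain ⟨hy1, hy2, hy3, hy4⟩ := hIU y hy hyU
        have hb' : b x = b y := by rw [hx2, hxy, ← hy2]
        by_contra hne
        rcases htot x hxU y hyU hb' with h | h
        · have := hx4 y (Finset.mem_filter.2 ⟨hyU, hb', lt_of_le_of_ne h hne⟩)
          exact (hy3.trans_le (hxy ▸ this)).false
        · have := hy4 x (Finset.mem_filter.2 ⟨hxU, hb'.symm, lt_of_le_of_ne h (Ne.symm hne)⟩)
          exact (hx3.trans_le (hxy ▸ this)).false
      · rw [hxy, hσ1 y hyU] at hx1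
        exact absurd hx1 hyU
    · rw [hσ1 x hxU] at hxy
      by_cases hyU : y ∈ U
      · exact absurd (hxy ▸ (hIU y hy hyU).1) hxU
      · rw [hxy, hσ1 y hyU]
  · intro x hx
    by_cases hxU : x ∈ U
    · exact (hIU x hx hxU).2.2.1.le
    · rw [hσ1 x hxU]
  · rw [← hU, ← Finset.card_compl]
    refine Finset.card_le_card fun x hx => ?_
    rw [Finset.mem_filter] at hx
    exact Finset.mem_compl.2 fun hxU => (hIU x hx.1 hxU).2.2.1.ne' hx.2

/-! ### Genericity by specialisation -/

/-- The matrix of indeterminates indexed by the pairs `i < j`. -/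
noncomputable def genericStrictMatrix (P : Type*) [PartialOrder P] :
    Matrix P P (MvPolynomial {p : P × P // p.1 < p.2} ℚ) := by
  classical
  exact Matrix.of fun i j => if h : i < j then MvPolynomial.X ⟨(i, j), h⟩ else 0

/-- For a strictly triangular matrix with algebraically independent entries, some minor of the
pencil of corank `k` has a nonzero coefficient of degree at most `n - c_k`. -/
theorem exists_minor_pencil_generic {P : Type*} [PartialOrder P] [Fintype P] [DecidableEq P]
    (M : Matrix P P ℂ) (hM : ∀ i j, M i j ≠ 0 → i < j)
    (hgen : AlgebraicIndependent ℚ (fun p : {p : P × P // p.1 < p.2} => M p.1.1 p.1.2)) (k : ℕ) :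
    ∃ r s : Fin (Fintype.card P - k) → P, ∃ l ≤ Fintype.card P - maxChainUnion P k,
      ((M.pencil.submatrix r s).det).coeff l ≠ 0 := by
  classical
  obtain ⟨I, σ, hI, hinj, hle, hcard⟩ := exists_chain_successor (P := P) k
  let N : Matrix P P ℚ := Matrix.of fun i j => if i ∈ I ∧ σ i = j ∧ i ≠ j then 1 else 0
  have hN : ∀ i j, N i j ≠ 0 → i ∈ I ∧ σ i = j ∧ i ≠ j := fun i j h => by
    by_contra hcon
    exact h (if_neg hcon)
  let f : P → ℤ := fun x => ((Finset.univ.filter fun y => y < x).card : ℤ)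
  have hf : ∀ x y, x < y → f x < f y := by
    intro x y hxy
    refine Int.ofNat_lt.2 (Finset.card_lt_card ?_)
    refine Finset.ssubset_iff_of_subset (fun z hz => ?_) |>.2 ⟨x, by simpa using hxy, by simp⟩
    simp only [Finset.mem_filter, Finset.mem_univ, true_and] at hz ⊢
    exact hz.trans hxy
  obtain ⟨r, s, l, hl, hne⟩ := N.exists_minor_pencil_coeff_ne_zero I σ f hI
    (by
      rintro i hi j hj hij (h | h)
      · refine hf _ _ (lt_of_le_of_ne (h ▸ hle j hj) (Ne.symm hij))
      · exact absurd (hinj hi hj (hN _ _ h).2.1) hij)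
    (by
      intro i hi h
      have : N i (σ i) = 1 := if_pos ⟨hi, rfl, Ne.symm h⟩
      rw [this]
      exact one_ne_zero)
    (by
      intro i
      exact if_neg fun h => h.2.2 rfl)
  refine ⟨r, s, l, hl.trans hcard, ?_⟩
  let G := genericStrictMatrix P
  have hGN : G.map (MvPolynomial.aeval (R := ℚ)
      (fun p : {p : P × P // p.1 < p.2} => N p.1.1 p.1.2)).toRingHom = N := by
    ext i j
    by_cases h : i < j
    · simp [G, genericStrictMatrix, h]
    · have : N i j = 0 := by
        by_contra h0
        obtain ⟨h1, h2, h3⟩ := hN i j h0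
        exact h (lt_of_le_of_ne (h2 ▸ hle i h1) h3)
      simp [G, genericStrictMatrix, h, this]
  have hGM : G.map (MvPolynomial.aeval (R := ℚ)
      (fun p : {p : P × P // p.1 < p.2} => M p.1.1 p.1.2)).toRingHom = M := by
    ext i j
    by_cases h : i < j
    · simp [G, genericStrictMatrix, h]
    · have : M i j = 0 := by
        by_contra h0
        exact h (hM i j h0)
      simp [G, genericStrictMatrix, h, this]
  rw [← hGN, ← Matrix.map_det_pencil_submatrix, Polynomial.coeff_map] at hne
  rw [← hGM, ← Matrix.map_det_pencil_submatrix, Polynomial.coeff_map]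
  intro h0
  refine hne ?_
  -- The coefficient is a rational polynomial in the indeterminates; if it vanished at the entries
  -- of `M`, it would be the zero polynomial.
  have : (G.pencil.submatrix r s).det.coeff l = 0 := hgen (h0.trans (map_zero _).symm)
  rw [this, map_zero]

/-- A nilpotent element of the incidence algebra is strictly triangular. -/
theorem lt_of_mem_incidenceMatrixAlgebra {P : Type*} [PartialOrder P] [Fintype P] [DecidableEq P]
    {M : Matrix P P ℂ} (hM : M ∈ incidenceMatrixAlgebra P) (hnil : IsNilpotent M) (i j : P)
    (h : M i j ≠ 0) : i < j := by
  refine lt_of_le_of_ne (hM i j h) ?_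
  rintro rfl
  have hpow : ∀ a : ℕ, (M ^ a) i i = M i i ^ a := by
    intro a
    induction a with
    | zero => simp
    | succ a ih =>
      rw [pow_succ, Matrix.mul_apply, Finset.sum_eq_single i, ih, pow_succ]
      · intro l _ hl
        by_contra h0
        have h1 := (incidenceMatrixAlgebra P).pow_mem hM a i l (left_ne_zero_of_mul h0)
        exact hl (le_antisymm (hM l i (right_ne_zero_of_mul h0)) h1)
      · simp
  obtain ⟨a, ha⟩ := hnil
  exact h (eq_zero_of_pow_eq_zero (by rw [← hpow a, ha]; rfl))

/-! ### Jordan chains of a nilpotent endomorphism -/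

/-- The monomial basis of `ℂ[X] ⧸ (X ^ m)`. -/
theorem exists_basis_quotient_X_pow (m : ℕ) :
    ∃ b : Module.Basis (Fin m) ℂ (ℂ[X] ⧸ Submodule.span ℂ[X] {(X : ℂ[X]) ^ m}),
      ∀ j, b j = Submodule.Quotient.mk (X ^ (j : ℕ)) := by
  have hmon : (X ^ m : ℂ[X]).Monic := monic_X_pow m
  let B := (AdjoinRoot.powerBasis' hmon)
  have hdim : B.dim = m := by simp [B, AdjoinRoot.powerBasis'_dim]
  let b : Module.Basis (Fin m) ℂ (AdjoinRoot (X ^ m : ℂ[X])) := B.basis.reindex (finCongr hdim)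
  refine ⟨b, fun j => ?_⟩
  have : b j = AdjoinRoot.mk (X ^ m : ℂ[X]) (X ^ (j : ℕ)) := by
    simp [b, B, AdjoinRoot.powerBasis'_gen]
  exact this

/-- A nilpotent endomorphism has a basis consisting of Jordan chains. -/
theorem exists_basis_jordan_chains {V : Type*} [AddCommGroup V] [Module ℂ V] [Module.Finite ℂ V]
    (φ : Module.End ℂ V) (hφ : IsNilpotent φ) :
    ∃ (d : ℕ) (m : Fin d → ℕ) (b : Module.Basis (Σ i, Fin (m i)) ℂ V),
      ∀ i (j : Fin (m i)), φ (b ⟨i, j⟩) =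
        if h : (j : ℕ) + 1 < m i then b ⟨i, ⟨j + 1, h⟩⟩ else 0 := by
  obtain ⟨a, ha⟩ := hφ
  -- With `X` acting as `φ`, nilpotency is `X`-power torsion, so the structure theorem over `ℂ[X]`
  -- yields cyclic summands.
  have htors : Module.IsTorsion' (Module.AEval' φ) (Submonoid.powers (X : ℂ[X])) := by
    intro x
    refine ⟨⟨X ^ a, a, rfl⟩, ?_⟩
    apply (Module.AEval.of ℂ V φ).symm.injective
    change (Module.AEval.of ℂ V φ).symm ((X ^ a : ℂ[X]) • x) = _
    rw [Module.AEval.of_symm_smul, aeval_X_pow, ha, zero_smul, map_zero]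
  obtain ⟨d, m, ⟨e⟩⟩ := Module.torsion_by_prime_power_decomposition
    (Polynomial.irreducible_X (R := ℂ)) htors
  choose c hc using exists_basis_quotient_X_pow
  let B : Module.Basis (Σ i, Fin (m i)) ℂ
      (DirectSum (Fin d) fun i => ℂ[X] ⧸ Submodule.span ℂ[X] {(X : ℂ[X]) ^ m i}) :=
    DFinsupp.basis fun i => c (m i)
  have hB : ∀ i j, B ⟨i, j⟩ = DirectSum.lof ℂ[X] (Fin d)
      (fun i => ℂ[X] ⧸ Submodule.span ℂ[X] {(X : ℂ[X]) ^ m i}) i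
        (Submodule.Quotient.mk (X ^ (j : ℕ))) := by
    intro i j
    rw [← hc]
    refine B.repr.injective ?_
    rw [Module.Basis.repr_self]
    ext ⟨i', j'⟩
    change _ = (c (m i')).repr (DirectSum.lof ℂ[X] (Fin d)
      (fun i => ℂ[X] ⧸ Submodule.span ℂ[X] {(X : ℂ[X]) ^ m i}) i (c (m i) j) i') j'
    by_cases h : i = i'
    · subst h
      rw [DirectSum.lof_apply, Module.Basis.repr_self]
      simp [Finsupp.single_apply]
    · rw [DirectSum.lof_eq_of, DirectSum.of_eq_of_ne _ _ _ (Ne.symm h)]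
      simp [h]
  let e' := (e.restrictScalars ℂ).symm.trans (Module.AEval.of ℂ V φ).symm
  refine ⟨d, m, B.map e', fun i j => ?_⟩
  have key : ∀ y, φ (e' y) = e' ((X : ℂ[X]) • y) := by
    intro y
    change φ ((Module.AEval.of ℂ V φ).symm (e.symm y)) =
      (Module.AEval.of ℂ V φ).symm (e.symm ((X : ℂ[X]) • y))
    rw [map_smul, Module.AEval.of_symm_X_smul]
    rfl
  rw [Module.Basis.map_apply, key, hB, ← map_smul, ← Submodule.Quotient.mk_smul, smul_eq_mul,
    ← pow_succ']
  split_ifs with h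
  · rw [Module.Basis.map_apply, hB]
  · have h1 : (j : ℕ) + 1 = m i := by omega
    rw [h1, (Submodule.Quotient.mk_eq_zero _).2 (Submodule.mem_span_singleton_self _), map_zero,
      map_zero]

/-! ### Chains in a disjoint union of chains -/

theorem Finset.sum_le_sum_range_of_antitone {ν : ℕ → ℕ} (hν : Antitone ν) (T : Finset ℕ) {k : ℕ}
    (hT : T.card ≤ k) : ∑ i ∈ T, ν i ≤ ∑ i ∈ Finset.range k, ν i := by
  have h1 : (T \ Finset.range k).card ≤ (Finset.range k \ T).card := by
    have := Finset.card_sdiff_add_card_inter T (Finset.range k)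
    have := Finset.card_sdiff_add_card_inter (Finset.range k) T
    rw [Finset.inter_comm] at this
    rw [Finset.card_range] at this
    omega
  rw [← Finset.sum_inter_add_sum_sdiff T (Finset.range k),
    ← Finset.sum_inter_add_sum_sdiff (Finset.range k) T, Finset.inter_comm]
  gcongr 1
  -- The value `ν k` separates the terms exchanged between the two index sets.
  calc ∑ i ∈ T \ Finset.range k, ν i ≤ (T \ Finset.range k).card • ν k :=
        Finset.sum_le_card_nsmul _ _ _ fun i hi => hν (by simpa using (Finset.mem_sdiff.1 hi).2)
    _ ≤ (Finset.range k \ T).card • ν k := by gcongr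
    _ ≤ ∑ i ∈ Finset.range k \ T, ν i :=
        Finset.card_nsmul_le_sum _ _ _ fun i hi => hν (by
          have := Finset.mem_range.1 (Finset.mem_sdiff.1 hi).1
          omega)

theorem Finset.sum_extend_zero {r : ℕ} (size : Fin r → ℕ) (T : Finset ℕ) :
    ∑ i ∈ T, (if h : i < r then size ⟨i, h⟩ else 0) =
      ∑ i : Fin r, if (i : ℕ) ∈ T then size i else 0 := by
  have e : ∀ i : Fin r, (if (i : ℕ) ∈ T then size i else 0) =
      (fun a : ℕ => if a ∈ T then (if h : a < r then size ⟨a, h⟩ else 0) else 0) i := by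
    intro i
    simp
  rw [Finset.sum_congr rfl fun i _ => e i, Fin.sum_univ_eq_sum_range
      (fun a : ℕ => if a ∈ T then (if h : a < r then size ⟨a, h⟩ else 0) else 0), ← Finset.sum_filter,
    Finset.filter_mem_eq_inter, Finset.inter_comm]
  refine (Finset.sum_subset Finset.inter_subset_left fun i hi hi' => dif_neg fun h => hi' ?_).symm
  exact Finset.mem_inter.2 ⟨hi, Finset.mem_range.2 h⟩

theorem card_sigma_filter_fst {r : ℕ} (size : Fin r → ℕ) (p : Fin r → Prop) [DecidablePred p] :
    (Finset.univ.filter fun x : Σ i, Fin (size i) => p x.1).card =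
      ∑ i, if p i then size i else 0 := by
  rw [Finset.card_filter, Fintype.sum_sigma]
  refine Finset.sum_congr rfl fun i _ => ?_
  by_cases h : p i <;> simp [h]

theorem antitone_extend_zero {r : ℕ} {size : Fin r → ℕ} (h : Antitone size) :
    Antitone fun i => if h : i < r then size ⟨i, h⟩ else 0 := by
  intro i j hij
  by_cases hj : j < r
  · have hi : i < r := hij.trans_lt hj
    simpa [hi, hj] using h (show (⟨i, hi⟩ : Fin r) ≤ ⟨j, hj⟩ from hij)
  · simp [hj]

/-- In a disjoint union of `r` chains, `k` chains cover at most as many elements as the `k`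
largest components. -/
theorem maxChainUnion_sigma_le {r : ℕ} {size : Fin r → ℕ} (hsize : Antitone size) (k : ℕ) :
    maxChainUnion (Σ i, Fin (size i)) k ≤
      ∑ i ∈ Finset.range k, if h : i < r then size ⟨i, h⟩ else 0 := by
  classical
  obtain ⟨C, hC, hmax⟩ := (maxChainUnion_isGreatest (Σ i, Fin (size i)) k).1
  have hblock : ∀ a, ∃ i : ℕ, ∀ x ∈ C a, (x.1 : ℕ) = i := by
    intro a
    by_cases hne : (C a).Nonempty
    · obtain ⟨y, hy⟩ := hne
      refine ⟨y.1, fun x hx => ?_⟩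
      rcases (hC a).total hx hy with h | h
      · rw [(Sigma.le_def.1 h).1]
      · rw [(Sigma.le_def.1 h).1]
    · exact ⟨0, fun x hx => absurd ⟨x, hx⟩ hne⟩
  choose b hb using hblock
  let T : Finset ℕ := Finset.univ.image b
  have hT : T.card ≤ k := Finset.card_image_le.trans_eq (by simp)
  refine le_trans ?_ (Finset.sum_le_sum_range_of_antitone (antitone_extend_zero hsize) T hT)
  rw [Finset.sum_extend_zero, ← card_sigma_filter_fst size fun i => (i : ℕ) ∈ T, ← hmax,
    ← Set.ncard_coe_finset]
  refine Set.ncard_le_ncard (fun x hx => ?_) (Set.toFinite _)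
  obtain ⟨a, ha⟩ := Set.mem_iUnion.1 hx
  simp only [Finset.coe_filter, Finset.mem_univ, true_and]
  exact Finset.mem_image.2 ⟨a, Finset.mem_univ a, (hb a x ha).symm⟩

/-! ### Minors of the Jordan pencil -/

/-- The nilpotent matrix with Jordan blocks of the given sizes. -/
abbrev nilpotentJordan {r : ℕ} (size : Fin r → ℕ) :
    Matrix (Σ i, Fin (size i)) (Σ i, Fin (size i)) ℂ :=
  Matrix.blockDiagonal' fun i => jordanBlock 0 (size i)

theorem nilpotentJordan_apply {r : ℕ} (size : Fin r → ℕ) (x y : Σ i, Fin (size i)) :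
    nilpotentJordan size x y = if x.1 = y.1 ∧ (x.2 : ℕ) + 1 = y.2 then 1 else 0 := by
  obtain ⟨i, p⟩ := x
  obtain ⟨j, q⟩ := y
  by_cases h : i = j
  · subst h
    by_cases hpq : p = q
    · simp [jordanBlock, hpq]
    · simp [jordanBlock, hpq]
  · simp [Matrix.blockDiagonal'_apply_ne _ _ _ h, h]

/-- Makes `X_pow_dvd_minor_pencil` applicable to the Jordan matrix. -/
theorem lt_of_nilpotentJordan_ne_zero {r : ℕ} (size : Fin r → ℕ) (x y : Σ i, Fin (size i))
    (h : nilpotentJordan size x y ≠ 0) : x < y := by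
  rw [nilpotentJordan_apply] at h
  obtain ⟨i, p⟩ := x
  obtain ⟨j, q⟩ := y
  obtain ⟨h1, h2⟩ : i = j ∧ (p : ℕ) + 1 = q := by_contra fun hc => h (if_neg hc)
  subst h1
  exact Sigma.mk_lt_mk_iff.2 (Fin.lt_def.2 (by omega))

/-- Select the superdiagonal ones in the first `k` blocks and the diagonal `X` in all others; only
the latter contribute to the degree. -/
theorem exists_minor_pencil_nilpotentJordan {r : ℕ} (size : Fin r → ℕ) (k : ℕ) :
    ∃ u v : Fin (Fintype.card (Σ i, Fin (size i)) - k) → Σ i, Fin (size i),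
      ∃ l, l + ∑ i ∈ Finset.range k, (if h : i < r then size ⟨i, h⟩ else 0) ≤
          Fintype.card (Σ i, Fin (size i)) ∧
        (((nilpotentJordan size).pencil.submatrix u v).det).coeff l ≠ 0 := by
  classical
  let I : Finset (Σ i, Fin (size i)) :=
    Finset.univ.filter fun x => (x.1 : ℕ) < k → (x.2 : ℕ) + 1 < size x.1
  let σ : (Σ i, Fin (size i)) → Σ i, Fin (size i) := fun x =>
    if h : (x.1 : ℕ) < k ∧ (x.2 : ℕ) + 1 < size x.1 then ⟨x.1, ⟨x.2 + 1, h.2⟩⟩ else x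
  -- The sign flips because the unselected entries are the diagonal `X` in the first `k` blocks and
  -- the superdiagonal ones elsewhere.
  let f : (Σ i, Fin (size i)) → ℤ := fun x =>
    if (x.1 : ℕ) < k then ((x.2 : ℕ) : ℤ) else -((x.2 : ℕ) : ℤ)
  have hI : ∀ x ∈ I, (x.1 : ℕ) < k → (x.2 : ℕ) + 1 < size x.1 := fun x hx =>
    (Finset.mem_filter.1 hx).2
  have hσ1 : ∀ x, ∀ h : (x.1 : ℕ) < k ∧ (x.2 : ℕ) + 1 < size x.1,
      σ x = ⟨x.1, ⟨x.2 + 1, h.2⟩⟩ := fun x h => dif_pos h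
  have hσ2 : ∀ x, ¬ (x.1 : ℕ) < k → σ x = x := fun x h => dif_neg fun h' => h h'.1
  have hext : ∀ x y : Σ i, Fin (size i), x.1 = y.1 → (x.2 : ℕ) = y.2 → x = y := by
    rintro ⟨i, p⟩ ⟨j, q⟩ h1 h2
    obtain rfl : i = j := h1
    obtain rfl : p = q := Fin.ext h2
    rfl
  have hJ : ∀ x y, nilpotentJordan size x y ≠ 0 → x.1 = y.1 ∧ (x.2 : ℕ) + 1 = y.2 :=
    fun x y h => by_contra fun hc => h (by rw [nilpotentJordan_apply, if_neg hc])
  have hcard : Fintype.card (Σ i, Fin (size i)) - k ≤ I.card := by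
    have hc : ∀ x ∈ Iᶜ, (x.1 : ℕ) < k ∧ (x.2 : ℕ) + 1 = size x.1 := by
      intro x hx
      simp only [I, Finset.mem_compl, Finset.mem_filter, Finset.mem_univ, true_and,
        Classical.not_imp] at hx
      exact ⟨hx.1, by omega⟩
    have hle : Iᶜ.card ≤ (Finset.range k).card := by
      refine Finset.card_le_card_of_injOn (fun x => (x.1 : ℕ)) (fun x hx => ?_)
        (fun x hx y hy hxy => ?_)
      · simpa using (hc x hx).1
      · have h1 : x.1 = y.1 := Fin.ext hxy
        have hx' := (hc x hx).2
        have hy' := (hc y hy).2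
        have h2 : size x.1 = size y.1 := by rw [h1]
        exact hext x y h1 (by omega)
    rw [Finset.card_compl, Finset.card_range] at hle
    omega
  obtain ⟨u, v, l, hl, hne⟩ :=
    (nilpotentJordan size).exists_minor_pencil_coeff_ne_zero I σ f hcard
    (by
      rintro x hx y hy hxy (h | h)
      · by_cases hy' : (y.1 : ℕ) < k
        · rw [hσ1 y ⟨hy', hI y hy hy'⟩] at h
          subst h
          simp [f, hy']
        · exact absurd (h.symm.trans (hσ2 y hy')) hxy
      · obtain ⟨h1, h2⟩ := hJ _ _ h
        by_cases hy' : (y.1 : ℕ) < k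
        · rw [hσ1 y ⟨hy', hI y hy hy'⟩] at h1 h2
          refine absurd (hext x y h1 ?_) hxy
          simpa using h2
        · rw [hσ2 y hy'] at h1 h2
          simp only [f, h1, hy', if_false]
          omega)
    (by
      intro x hx h
      have hx' : (x.1 : ℕ) < k := by_contra fun hc => h (hσ2 x hc)
      rw [hσ1 x ⟨hx', hI x hx hx'⟩, nilpotentJordan_apply, if_pos ⟨rfl, rfl⟩]
      exact one_ne_zero)
    (by
      intro x
      rw [nilpotentJordan_apply, if_neg]
      rintro ⟨-, h⟩
      omega)
  refine ⟨u, v, l, ?_, hne⟩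
  have hloop : I.filter (fun x => σ x = x) ⊆ (Finset.univ.filter fun x => (x.1 : ℕ) ∈ Finset.range k)ᶜ := by
    intro x hx
    obtain ⟨hx, hx'⟩ := Finset.mem_filter.1 hx
    simp only [Finset.mem_compl, Finset.mem_filter, Finset.mem_univ, true_and, Finset.mem_range]
    intro hk
    rw [hσ1 x ⟨hk, hI x hx hk⟩] at hx'
    have := congrArg (fun z => (z.2 : ℕ)) hx'
    simp at this
  have h1 := hl.trans (Finset.card_le_card hloop)
  rw [Finset.card_compl, card_sigma_filter_fst size fun i => (i : ℕ) ∈ Finset.range k,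
    ← Finset.sum_extend_zero] at h1
  have h2 : ∑ i ∈ Finset.range k, (if h : i < r then size ⟨i, h⟩ else 0) ≤
      Fintype.card (Σ i, Fin (size i)) := by
    rw [Finset.sum_extend_zero, ← card_sigma_filter_fst size fun i => (i : ℕ) ∈ Finset.range k]
    exact Finset.card_le_univ _
  omega

/-! ### Existence of the Jordan form -/

/-- Nilpotent complex matrices are conjugate to a nilpotent Jordan matrix. -/
theorem exists_isJordanPartition_of_isNilpotent {P : Type*} [Fintype P] [DecidableEq P]
    (M : Matrix P P ℂ) (hM : IsNilpotent M) : ∃ ν, IsJordanPartition M ν := by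
  classical
  -- The chain vectors become rows of `T`, on which `M` acts from the right, hence the transpose.
  have hnil : IsNilpotent (Matrix.toLin' M.transpose) := by
    obtain ⟨a, ha⟩ := hM
    refine ⟨a, ?_⟩
    rw [← Matrix.toLin'_pow, ← Matrix.transpose_pow, ha, Matrix.transpose_zero, map_zero]
  obtain ⟨d, m, b, hb⟩ := exists_basis_jordan_chains _ hnil
  -- The structure theorem may produce zero summands, which are not Jordan blocks.
  let ι := {i : Fin d // 0 < m i}
  let ρ₀ : Fin (Fintype.card ι) ≃ ι := (Fintype.equivFin ι).symm
  let ρ : Fin (Fintype.card ι) ≃ ι :=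
    (Tuple.sort fun a => OrderDual.toDual (m (ρ₀ a))).trans ρ₀
  let size : Fin (Fintype.card ι) → ℕ := fun a => m (ρ a)
  have hanti : Antitone size := fun x y hxy =>
    Tuple.monotone_sort (fun a => OrderDual.toDual (m (ρ₀ a))) hxy
  let τ : (Σ a, Fin (size a)) ≃ Σ i, Fin (m i) := Equiv.ofBijective (fun x => ⟨ρ x.1, x.2⟩) (by
    constructor
    · rintro ⟨x, p⟩ ⟨y, q⟩ h
      obtain rfl : x = y := ρ.injective (Subtype.ext (congrArg Sigma.fst h))
      simpa using h
    · rintro ⟨i, p⟩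
      obtain ⟨x, hx⟩ := ρ.surjective ⟨i, p.pos⟩
      have hi : (ρ x : Fin d) = i := by rw [hx]
      subst hi
      exact ⟨⟨x, p⟩, rfl⟩)
  let e : (Σ a, Fin (size a)) ≃ P := τ.trans (b.indexEquiv (Pi.basisFun ℂ P))
  let c : Module.Basis P ℂ (P → ℂ) := b.reindex (b.indexEquiv (Pi.basisFun ℂ P))
  let T : Matrix P P ℂ := Matrix.of fun i => c i
  have hT : IsUnit T := Matrix.linearIndependent_rows_iff_isUnit.1 c.linearIndependent
  obtain ⟨U, hU⟩ := hT
  have hce : ∀ x, c (e x) = b ⟨ρ x.1, x.2⟩ := by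
    intro x
    simp only [c, e, Module.Basis.reindex_apply, Equiv.trans_apply, Equiv.symm_apply_apply]
    rfl
  have hrel : U.val * M = Matrix.reindex e e (nilpotentJordan size) * U.val := by
    rw [hU]
    ext i q
    obtain ⟨x, rfl⟩ := e.surjective i
    have h1 : (T * M) (e x) q = (Matrix.toLin' M.transpose (c (e x))) q := by
      rw [Matrix.toLin'_apply, Matrix.mulVec_transpose]
      rfl
    rw [h1, hce, hb, Matrix.mul_apply, ← e.sum_comp]
    simp only [Matrix.reindex_apply, Matrix.submatrix_apply, Equiv.symm_apply_apply,
      nilpotentJordan_apply, ite_mul, one_mul, zero_mul]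
    split_ifs with h
    · rw [Finset.sum_eq_single (⟨x.1, ⟨x.2 + 1, h⟩⟩ : Σ a, Fin (size a))]
      · rw [if_pos ⟨rfl, rfl⟩]
        change _ = c _ q
        rw [hce]
      · rintro ⟨y, p⟩ _ hne
        refine if_neg fun hy => hne ?_
        obtain ⟨h1, h2⟩ := hy
        dsimp only at h1
        subst h1
        congr 1
        exact Fin.ext h2.symm
      · simp
    · refine (Finset.sum_eq_zero ?_).symm
      rintro ⟨y, p⟩ _
      refine if_neg ?_
      rintro ⟨h1, h2⟩
      dsimp only at h1
      subst h1
      refine h ?_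
      rw [h2]
      exact p.2
  refine ⟨_, Fintype.card ι, size, 0, e, U⁻¹, fun i => (ρ i).2, hanti, ?_, fun k => rfl⟩
  change M = U⁻¹.val * Matrix.reindex e e (nilpotentJordan size) * U⁻¹⁻¹.val
  rw [inv_inv, mul_assoc, ← hrel, ← mul_assoc, Units.inv_mul, one_mul]

/-- In a Jordan form of a nilpotent matrix all eigenvalues vanish. -/
theorem eigenvalue_eq_zero_of_isNilpotent_blockDiagonal {r : ℕ} {size : Fin r → ℕ} {eig : Fin r → ℂ}
    (hpos : ∀ i, 0 < size i)
    (hnil : IsNilpotent (Matrix.blockDiagonal' fun i => jordanBlock (eig i) (size i))) :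
    eig = 0 := by
  ext i
  by_contra h
  have hmem : (Matrix.blockDiagonal' fun i => jordanBlock (eig i) (size i)) ∈
      incidenceMatrixAlgebra (Σ i, Fin (size i)) := by
    rintro ⟨x, p⟩ ⟨y, q⟩ hne
    by_cases hxy : x = y
    · subst hxy
      rw [Matrix.blockDiagonal'_apply_eq] at hne
      refine Sigma.mk_le_mk_iff.2 ?_
      by_contra hpq
      have h1 : p ≠ q := fun h => hpq h.le
      have h2 : (p : ℕ) + 1 ≠ q := fun h => hpq (Fin.le_def.2 (by omega))
      exact hne (by simp [jordanBlock, h1, h2])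
    · exact absurd (Matrix.blockDiagonal'_apply_ne _ _ _ hxy) hne
  refine lt_irrefl _ (lt_of_mem_incidenceMatrixAlgebra hmem hnil ⟨i, ⟨0, hpos i⟩⟩ ⟨i, ⟨0, hpos i⟩⟩ ?_)
  rw [Matrix.blockDiagonal'_apply_eq]
  simpa [jordanBlock] using h

theorem Matrix.pencil_reindex {P Q R : Type*} [DecidableEq P] [DecidableEq Q] [CommRing R]
    (e : P ≃ Q) (N : Matrix P P R) :
    (Matrix.reindex e e N).pencil = Matrix.reindex e e N.pencil := by
  ext1 i j
  simp [Matrix.pencil]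

/-! ### Comparison of exponents -/

/-- The partial sums of the Jordan partition of a generic nilpotent matrix are the numbers `c_k`. -/
theorem IsJordanPartition.sum_range_eq_maxChainUnion {P : Type*} [PartialOrder P] [Fintype P]
    [DecidableEq P] {M : Matrix P P ℂ} (hM : IsGenericNilpotent M) {ν : ℕ → ℕ}
    (hν : IsJordanPartition M ν) (k : ℕ) :
    ∑ i ∈ Finset.range k, ν i = maxChainUnion P k := by
  obtain ⟨r, size, eig, e, S, hpos, hanti, hconj, hsize⟩ := hν
  obtain rfl : ν = fun k => if h : k < r then size ⟨k, h⟩ else 0 := funext hsize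
  have hlt := lt_of_mem_incidenceMatrixAlgebra hM.mem hM.nilpotent
  have heig : eig = 0 := by
    refine eigenvalue_eq_zero_of_isNilpotent_blockDiagonal hpos ?_
    obtain ⟨a, ha⟩ := hM.nilpotent
    rw [hconj, Units.conj_pow, Units.mul_left_eq_zero, Units.mul_right_eq_zero] at ha
    exact (IsNilpotent.map_iff (Matrix.reindexAlgEquiv ℂ ℂ e).injective).1 ⟨a, ha⟩
  subst heig
  change M = S.val * Matrix.reindex e e (nilpotentJordan size) * S⁻¹.val at hconj
  have hcard : Fintype.card (Σ i, Fin (size i)) = Fintype.card P := Fintype.card_congr e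
  have hconj' : Matrix.reindex e e (nilpotentJordan size) = S⁻¹.val * M * S⁻¹⁻¹.val := by
    rw [hconj, inv_inv]
    simp [mul_assoc]
  have hkP := maxChainUnion_isGreatest P k
  have hle : maxChainUnion P k ≤ Fintype.card P := by
    obtain ⟨C, -, h⟩ := hkP.1
    rw [← h, ← Nat.card_eq_fintype_card]
    exact Set.ncard_le_card _
  apply le_antisymm
  -- Divisibility passes from `M` to the Jordan form; this direction needs no genericity.
  · obtain ⟨u, v, l, hl, hne⟩ := exists_minor_pencil_nilpotentJordan size k
    have hdvd : X ^ (Fintype.card P - maxChainUnion P k) ∣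
        ((nilpotentJordan size).pencil.submatrix u v).det := by
      have h := Matrix.dvd_minors_mul_mul M.pencil ((C : ℂ →+* ℂ[X]).mapMatrix S⁻¹.val)
        ((C : ℂ →+* ℂ[X]).mapMatrix S⁻¹⁻¹.val) (X_pow_dvd_minor_pencil M hlt
          (m := Fintype.card (Σ i, Fin (size i)) - k) (k := k) (by omega)) (e ∘ u) (e ∘ v)
      rw [← Matrix.pencil_conj, ← hconj', Matrix.pencil_reindex, Matrix.reindex_apply,
        Matrix.submatrix_submatrix] at h
      simpa [Function.comp_def, ← Function.comp_assoc] using h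
    have : Fintype.card P - maxChainUnion P k ≤ l := by
      by_contra hcon
      exact hne (Polynomial.X_pow_dvd_iff.1 hdvd l (by omega))
    dsimp only
    omega
  -- Divisibility passes back from the Jordan form to `M`, where genericity supplies a minor with a
  -- term of low degree.
  · refine le_trans ?_ (maxChainUnion_sigma_le hanti k)
    obtain ⟨u, v, l, hl, hne⟩ := exists_minor_pencil_generic M hlt hM.generic k
    have hdvd : X ^ (Fintype.card P - maxChainUnion (Σ i, Fin (size i)) k) ∣
        (M.pencil.submatrix u v).det := by
      rw [hconj, Matrix.pencil_conj]
      refine Matrix.dvd_minors_mul_mul _ _ _ (fun u v => ?_) u v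
      rw [Matrix.pencil_reindex, Matrix.reindex_apply, Matrix.submatrix_submatrix]
      have h := X_pow_dvd_minor_pencil _ (lt_of_nilpotentJordan_ne_zero size)
        (m := Fintype.card P - k) (k := k) (by omega) (e.symm ∘ u) (e.symm ∘ v)
      rwa [hcard] at h
    have : Fintype.card P - maxChainUnion (Σ i, Fin (size i)) k ≤ l := by
      by_contra hcon
      exact hne (Polynomial.X_pow_dvd_iff.1 hdvd l (by omega))
    omega

theorem theorem6p1 {P : Type*} [PartialOrder P] [Fintype P] [DecidableEq P]
    (M : Matrix P P ℂ) (hM : IsGenericNilpotent M) (ν : ℕ → ℕ) :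
    IsJordanPartition M ν ↔ ν = chainShape P := by
  have key : ∀ ν, IsJordanPartition M ν → ν = chainShape P := by
    intro ν hν
    ext k
    rw [chainShape, ← hν.sum_range_eq_maxChainUnion hM, ← hν.sum_range_eq_maxChainUnion hM,
      Finset.sum_range_succ, Nat.add_sub_cancel_left]
  refine ⟨key ν, ?_⟩
  rintro rfl
  -- Some Jordan partition exists, and `key` identifies it with `chainShape P`.
  obtain ⟨ν, hν⟩ := exists_isJordanPartition_of_isNilpotent M hM.nilpotent
  exact key ν hν ▸ hν
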